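/- For an integer $k\ge 1$ let $$P_k=\langle a,b \mid ab^{2^k}a^{-1}b^{2^k},\ ba^2b^{-1}a^2\rangle .$$ Call a non-empty finite subset $S$ of a group a \emph{non-unique product set} if no element of $SS=\{xy : x,y\in S\}$ can be written in exactly one way as $xy$ with $x,y\in S$. For positive odd integers $p,q$ such that $2^k$ divides $q-1$, define the following subsets of $P_k$: \begin{align*} X_0(p,q)&=\{a^{-p}b^{j} : -q+1\le j\le (2^k+1)q-2^k\},\\ X_i(p,q)&=\{b^ia^{-p}b^{j} : -q+1\le j\le (2^k+1)q\}\quad(1\le i\le 2^k-1),\\ Y_l(p,q)&=\{b^la^{p}b^{j} : -q+2\le j\le (2^k+1)q\}\quad(0\le l\le 2^k-1),\\ Z_0(p,q)&=\{b^{j} : -2^k\tfrac{q+1}{2}-(q-1)\le j\le 2^k\tfrac{q+1}{2}+(q-1)\}, \end{align*} and $$T(p,q)=\bigcup_{i=0}^{2^k-1}X_i(p,q)\ \cup\ \bigcup_{l=0}^{2^k-1}Y_l(p,q)\ \cup\ Z_0(p,q).$$ Then, for every $k\ge 1$: \begin{enumerate} \item $P_k$ contains arbitrarily large non-unique product sets: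 for every $n$ there is a non-unique product set $S\subset P_k$ with $|S|\ge n$. \item For all positive odd $p,q$ with $2^k\mid q-1$, the set $T(p,q)$ is a non-unique product set, and $|T(p,q)|=(2^{2k+1}+5\cdot 2^k+2)q-(2^k+1)$. \item For every positive odd $p$, the cardinality $|T(p,q)|$ is unbounded as $q$ ranges over the positive odd integers with $2^k\mid q-1$. \item For every positive odd $q$ with $2^k\mid q-1$, there are infinitely many distinct sets among the $T(p,q)$ with $p$ positive and odd (all of which have the same cardinality by (2)). \end{enumerate} -/

import Mathlib

open scoped Pointwise

/-- A non-unique product set of a group: a non-empty finite set `S` such that no element `z` of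
the product set `S * S` can be written as `z = x * y`, with `x` and `y` in `S`, in one way only. -/
def IsNonUniqueProductSet {G : Type*} [Group G] (S : Set G) : Prop :=
  S.Finite ∧ S.Nonempty ∧
    ∀ z ∈ S * S, ¬ ∃! w : G × G, w.1 ∈ S ∧ w.2 ∈ S ∧ w.1 * w.2 = z

namespace GroupP

/-- The relators `a b^(2^k) a⁻¹ b^(2^k)` and `b a² b⁻¹ a²`, where `a` and `b` are the free
generators with index `0` and `1`. -/
def rels (k : ℕ) : Set (FreeGroup (Fin 2)) :=
  {FreeGroup.of 0 * FreeGroup.of 1 ^ (2 ^ k) * (FreeGroup.of 0)⁻¹ * FreeGroup.of 1 ^ (2 ^ k),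
    FreeGroup.of 1 * FreeGroup.of 0 ^ 2 * (FreeGroup.of 1)⁻¹ * FreeGroup.of 0 ^ 2}

end GroupP

/-- The group `P_k = ⟨a, b ∣ a b^(2^k) a⁻¹ b^(2^k), b a² b⁻¹ a²⟩`. -/
abbrev GroupP (k : ℕ) : Type := PresentedGroup (GroupP.rels k)

namespace GroupP

/-- The generator `a` of `P_k`. -/
def a (k : ℕ) : GroupP k := PresentedGroup.of 0

/-- The generator `b` of `P_k`. -/
def b (k : ℕ) : GroupP k := PresentedGroup.of 1

/-- `X_0(p, q) = {a^(-p) b^j ∣ -q + 1 ≤ j ≤ (2^k + 1) q - 2^k}`. -/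
def X₀ (k : ℕ) (p q : ℤ) : Set (GroupP k) :=
  (fun j : ℤ => a k ^ (-p) * b k ^ j) '' Set.Icc (-q + 1) ((2 ^ k + 1) * q - 2 ^ k)

/-- `X_i(p, q) = {b^i a^(-p) b^j ∣ -q + 1 ≤ j ≤ (2^k + 1) q}`, used for `1 ≤ i ≤ 2^k - 1`. -/
def X (k : ℕ) (p q i : ℤ) : Set (GroupP k) :=
  (fun j : ℤ => b k ^ i * a k ^ (-p) * b k ^ j) '' Set.Icc (-q + 1) ((2 ^ k + 1) * q)

/-- `Y_l(p, q) = {b^l a^p b^j ∣ -q + 2 ≤ j ≤ (2^k + 1) q}`, used for `0 ≤ l ≤ 2^k - 1`. -/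
def Y (k : ℕ) (p q l : ℤ) : Set (GroupP k) :=
  (fun j : ℤ => b k ^ l * a k ^ p * b k ^ j) '' Set.Icc (-q + 2) ((2 ^ k + 1) * q)

/-- `Z_0(p, q) = {b^j ∣ |j| ≤ 2^k (q + 1) / 2 + (q - 1)}`; the division is exact for odd `q`. -/
def Z₀ (k : ℕ) (q : ℤ) : Set (GroupP k) :=
  (fun j : ℤ => b k ^ j) ''
    Set.Icc (-(2 ^ k * ((q + 1) / 2)) - (q - 1)) (2 ^ k * ((q + 1) / 2) + (q - 1))

/-- The set `T(p, q)`, the union of the `b`-progressions above. -/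
def T (k : ℕ) (p q : ℤ) : Set (GroupP k) :=
  (X₀ k p q ∪ ⋃ i ∈ Set.Icc (1 : ℤ) (2 ^ k - 1), X k p q i) ∪
    (⋃ l ∈ Set.Icc (0 : ℤ) (2 ^ k - 1), Y k p q l) ∪ Z₀ k q

end GroupP

/-! Write N = 2^k. Odd powers of a invert b^N, and odd powers of b invert a^2. Every element of T is
a power of b or a word b^i a^e b^j with e = p or e = -p and 0 ≤ i < N. Three actions by permutations
show that these forms are unique, which gives the cardinality and recovers p from T
(`word_injective`).

For non-uniqueness, each product xy with x, y in T gets a second factorization with a different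
first factor. As T is made of intervals of b-exponents, usually a letter b, or a block b^N that
crosses an odd power of a and is inverted, can move between the factors. This fails only at the ends
of the intervals (`extremal_cases`). There a relation changes the signs of the a-exponents
(`word_mul_word_flip`, `word_mul_word_shift`), or the a-exponents cancel and leave a power of b that
is a product of two elements of Z_0 (`word_mul_word_cancel`). The interval ends are chosen so that
the new factors stay in T. -/

section Relations

variable {G : Type*} [Group G] {a b : G} {N : ℕ}

/-- Odd powers of `a` invert the powers of `b ^ N`. -/
theorem zpow_odd_mul_zpow_of_relator (h : a * b ^ N * a⁻¹ * b ^ N = 1) {e : ℤ} (he : Odd e)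
    (t : ℤ) : a ^ e * b ^ (N * t : ℤ) = b ^ (-(N * t) : ℤ) * a ^ e := by
  have h1 : SemiconjBy a (b ^ N) (b ^ N)⁻¹ := by
    rw [mul_eq_one_iff_eq_inv] at h
    exact mul_inv_eq_iff_eq_mul.mp h
  have h2 : SemiconjBy (a * a) (b ^ N) (b ^ N) := by
    simpa using h1.inv_right.mul_left h1
  obtain ⟨n, rfl⟩ := he
  have h3 : SemiconjBy (a ^ (2 * n + 1)) (b ^ N) (b ^ N)⁻¹ := by
    rw [add_comm, zpow_add, zpow_one, zpow_mul, zpow_ofNat, pow_two]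
    exact h1.mul_left (Commute.zpow_left h2 n)
  have h4 := (h3.zpow_right t).eq
  rwa [inv_zpow', ← zpow_natCast, ← zpow_mul, ← zpow_mul, mul_neg] at h4

/-- Odd powers of `b` invert the even powers of `a`. -/
theorem zpow_odd_mul_zpow_even_of_relator (h : b * a ^ 2 * b⁻¹ * a ^ 2 = 1) {s e : ℤ}
    (hs : Odd s) (he : Even e) : b ^ s * a ^ e = a ^ (-e) * b ^ s := by
  obtain ⟨t, rfl⟩ := he.two_dvd
  simpa using zpow_odd_mul_zpow_of_relator (N := 2) h hs t

/-- Split a^(2p) off the last a^p and carry it across b^s, which inverts it because s is odd. -/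
theorem zpow_mul_zpow_mul_zpow_of_odd (h : b * a ^ 2 * b⁻¹ * a ^ 2 = 1) {s : ℤ}
    (hs : Odd s) (p : ℤ) : a ^ p * b ^ s * a ^ p = a ^ (-p) * b ^ s * a ^ (-p) := by
  have h1 := zpow_odd_mul_zpow_even_of_relator h hs (e := 2 * p) (even_two_mul p)
  have h2 : a ^ p = a ^ (2 * p) * a ^ (-p) := by rw [← zpow_add]; congr 1; ring
  calc a ^ p * b ^ s * a ^ p = a ^ p * (b ^ s * a ^ (2 * p)) * a ^ (-p) := by
        nth_rw 2 [h2]; group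
    _ = a ^ (-p) * b ^ s * a ^ (-p) := by rw [h1]; group

theorem zpow_mul_zpow_mul_zpow_of_even (h : b * a ^ 2 * b⁻¹ * a ^ 2 = 1) {s : ℤ}
    (hs : Even s) (p : ℤ) : a ^ p * b ^ s * a ^ (-p) = a ^ (-p) * b ^ s * a ^ p := by
  have h1 : b ^ s * a ^ (2 * p) = a ^ (2 * p) * b ^ s := by
    have h2 := zpow_odd_mul_zpow_even_of_relator h odd_one (e := 2 * p) (even_two_mul p)
    have h3 := zpow_odd_mul_zpow_even_of_relator h (hs.sub_odd odd_one) (even_two_mul p).neg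
    have hb : b ^ s = b ^ (s - 1) * b ^ (1 : ℤ) := by rw [← zpow_add, sub_add_cancel]
    rw [hb, mul_assoc, h2, ← mul_assoc, h3, neg_neg, mul_assoc]
  have h2 : a ^ p = a ^ (2 * p) * a ^ (-p) := by rw [← zpow_add]; congr 1; ring
  calc a ^ p * b ^ s * a ^ (-p) = a ^ (-p) * (a ^ (2 * p) * b ^ s) * a ^ (-p) := by
        nth_rw 1 [h2]; group
    _ = a ^ (-p) * b ^ s * a ^ p := by rw [← h1]; group

/-- The two a-powers merge into a^(2p) or a^(-2p) once b^(Nt) crosses one of them; a single b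
crossing a^(2p) then changes its sign. -/
theorem zpow_mul_sq_shift (h : a * b ^ N * a⁻¹ * b ^ N = 1) (h' : b * a ^ 2 * b⁻¹ * a ^ 2 = 1)
    {p : ℤ} (hp : Odd p) (i t m : ℤ) :
    b ^ i * a ^ p * b ^ (N * t : ℤ) * (a ^ p * b ^ m) =
      b ^ (i + 1) * a ^ (-p) * b ^ (N * t : ℤ) * (a ^ (-p) * b ^ (m - 1)) := by
  have h4 : a ^ p * b ^ (N * t : ℤ) * a ^ p = a ^ (p + p) * b ^ (-(N * t) : ℤ) := by
    have h1' := zpow_odd_mul_zpow_of_relator h hp (-t)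
    rw [mul_neg, neg_neg] at h1'
    rw [mul_assoc, ← h1', zpow_add, mul_assoc]
  have h5 : a ^ (-p) * b ^ (N * t : ℤ) * a ^ (-p) = a ^ (-(p + p)) * b ^ (-(N * t) : ℤ) := by
    have h1' := zpow_odd_mul_zpow_of_relator h hp.neg (-t)
    rw [mul_neg, neg_neg] at h1'
    rw [mul_assoc, ← h1', neg_add, zpow_add, mul_assoc]
  calc _ = b ^ i * (a ^ p * b ^ (N * t : ℤ) * a ^ p) * b ^ m := by simp only [mul_assoc]
    _ = b ^ i * (a ^ (p + p) * b ^ (1 : ℤ)) * b ^ (-(N * t) : ℤ) * b ^ (m - 1) := by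
        rw [h4]; group
    _ = b ^ i * (b ^ (1 : ℤ) * a ^ (-(p + p))) * b ^ (-(N * t) : ℤ) * b ^ (m - 1) := by
        rw [zpow_odd_mul_zpow_even_of_relator h' odd_one (e := -(p + p)) (Even.neg ⟨p, rfl⟩), neg_neg]
    _ = b ^ (i + 1) * (a ^ (-p) * b ^ (N * t : ℤ) * a ^ (-p)) * b ^ (m - 1) := by
        rw [h5, zpow_add]; simp only [mul_assoc]
    _ = _ := by simp only [mul_assoc]

end Relations

/-! ### The presentation, its permutation representations and the normal form -/

namespace GroupP

variable {k : ℕ}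

theorem relator_ab (k : ℕ) : a k * b k ^ (2 ^ k) * (a k)⁻¹ * b k ^ (2 ^ k) = 1 :=
  PresentedGroup.one_of_mem (rels := rels k) (Set.mem_insert _ _)

theorem relator_ba (k : ℕ) : b k * a k ^ 2 * (b k)⁻¹ * a k ^ 2 = 1 :=
  PresentedGroup.one_of_mem (rels := rels k) (Set.mem_insert_of_mem _ rfl)

/-- The homomorphism from `P_k` given by a pair of elements satisfying the relations. -/
def lift {H : Type*} [Group H] (x y : H) (hxy : x * y ^ (2 ^ k) * x⁻¹ * y ^ (2 ^ k) = 1)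
    (hyx : y * x ^ 2 * y⁻¹ * x ^ 2 = 1) : GroupP k →* H :=
  PresentedGroup.toGroup (f := ![x, y]) (rels := rels k) (by
    rintro r (rfl | rfl)
    · simpa using hxy
    · simpa using hyx)

section lift

variable {H : Type*} [Group H] {x y : H} {hxy : x * y ^ (2 ^ k) * x⁻¹ * y ^ (2 ^ k) = 1}
  {hyx : y * x ^ 2 * y⁻¹ * x ^ 2 = 1}

@[simp] theorem lift_a : lift x y hxy hyx (a k) = x := by simp [lift, a]

@[simp] theorem lift_b : lift x y hxy hyx (b k) = y := by simp [lift, b]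

end lift

/-- On ℤ, let a act by negation and b by translation by 1. -/
theorem b_zpow_injective : Function.Injective fun j : ℤ => b k ^ j := by
  let φ : GroupP k →* Equiv.Perm ℤ := lift (Equiv.neg ℤ) (Equiv.addRight 1)
    (by ext; simp) (by ext; simp [pow_two])
  intro i j hij
  have := congrArg (fun g => φ g 0) hij
  simpa [φ, map_zpow] using this

/-- Now a translates ℤ and b negates it, so a^e b^i sends 0 to e. The first relator acts trivially
because 2^k is even, which is where 0 < k enters. -/
theorem a_exponent_unique (hk : 0 < k) {e f i j : ℤ}
    (h : a k ^ e * b k ^ i = a k ^ f * b k ^ j) : e = f := by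
  have hneg : (Equiv.neg ℤ) ^ 2 = 1 := by ext; simp [pow_two]
  obtain ⟨n, rfl⟩ := Nat.exists_eq_succ_of_ne_zero hk.ne'
  have hpow : (Equiv.neg ℤ) ^ (2 ^ (n + 1)) = 1 := by rw [pow_succ', pow_mul, hneg, one_pow]
  let φ : GroupP (n + 1) →* Equiv.Perm ℤ := lift (Equiv.addRight 1) (Equiv.neg ℤ)
    (by rw [hpow]; ext; simp) (by ext; simp)
  have hb : ∀ j : ℤ, ((Equiv.neg ℤ) ^ j) 0 = 0 := fun j =>
    Equiv.Perm.zpow_apply_eq_self_of_apply_eq_self (by simp) j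
  have := congrArg (fun g => φ g 0) h
  simpa [φ, map_zpow, hb] using this

/-- The permutation `x ↦ x + 1` of `ZMod n`, fixing the added point `none`. -/
def shift (n : ℕ) : Equiv.Perm (Option (ZMod n)) := Equiv.optionCongr (Equiv.addRight 1)

theorem shift_zpow_none (n : ℕ) (i : ℤ) : (shift n ^ i) none = none :=
  Equiv.Perm.zpow_apply_eq_self_of_apply_eq_self (by simp [shift]) i

theorem shift_zpow_some (n : ℕ) (i : ℤ) (x : ZMod n) : (shift n ^ i) (some x) = some (x + i) := by
  have step : ∀ i : ℤ, (shift n ^ (i + 1)) (some x) = shift n ((shift n ^ i) (some x)) := by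
    intro i
    rw [add_comm, zpow_add, zpow_one, Equiv.Perm.mul_apply]
  induction i with
  | zero => simp
  | succ i ih => rw [step, ih]; simp [shift, add_assoc]
  | pred i ih =>
    apply (shift n).injective
    rw [← step, sub_add_cancel, ih]
    simp [shift, add_assoc]

theorem shift_pow_self (n : ℕ) : shift n ^ n = 1 := by
  have : shift n ^ (n : ℤ) = 1 := by
    ext x : 1
    cases x with
    | none => exact shift_zpow_none n n
    | some x => simpa using shift_zpow_some n n x
  exact_mod_cast this

/-- The permutation representation of `P_k` on `ZMod (2 ^ k)` with a point added, in which `a` acts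
by the transposition of `none` and `0`. -/
def toPerm (k : ℕ) : GroupP k →* Equiv.Perm (Option (ZMod (2 ^ k))) :=
  lift (Equiv.swap none (some 0)) (shift (2 ^ k)) (by rw [shift_pow_self]; simp)
    (by rw [pow_two, Equiv.swap_mul_self]; simp)

theorem toPerm_word_none {e : ℤ} (he : Odd e) (i j : ℤ) :
    toPerm k (b k ^ i * a k ^ e * b k ^ j) none = some (i : ZMod (2 ^ k)) := by
  obtain ⟨n, rfl⟩ := he
  have hswap : (Equiv.swap none (some (0 : ZMod (2 ^ k)))) ^ (2 * n + 1) =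
      Equiv.swap none (some 0) := by
    rw [zpow_add, zpow_one, zpow_mul, zpow_ofNat, pow_two, Equiv.swap_mul_self, one_zpow, one_mul]
  simp only [toPerm, map_mul, map_zpow, lift_a, lift_b, Equiv.Perm.mul_apply, shift_zpow_none,
    hswap, Equiv.swap_apply_left, shift_zpow_some, zero_add]

theorem toPerm_b_zpow_none (j : ℤ) : toPerm k (b k ^ j) none = none := by
  simp only [toPerm, map_zpow, lift_b, shift_zpow_none]

theorem word_ne_b_zpow {e : ℤ} (he : Odd e) (i j z : ℤ) :
    b k ^ i * a k ^ e * b k ^ j ≠ b k ^ z := by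
  intro h
  have := congrArg (fun g => toPerm k g none) h
  simp only [toPerm_word_none he, toPerm_b_zpow_none, reduceCtorEq] at this

/-- The normal form `b ^ i * a ^ e * b ^ j`, with `e` odd and `0 ≤ i < 2 ^ k`, is unique. -/
theorem word_injective (hk : 0 < k) {e e' i i' j j' : ℤ} (he : Odd e) (he' : Odd e')
    (hi : 0 ≤ i) (hi' : 0 ≤ i') (hik : i < 2 ^ k) (hik' : i' < 2 ^ k)
    (h : b k ^ i * a k ^ e * b k ^ j = b k ^ i' * a k ^ e' * b k ^ j') :
    i = i' ∧ e = e' ∧ j = j' := by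
  have h1 := congrArg (fun g => toPerm k g none) h
  simp only [toPerm_word_none he, toPerm_word_none he', Option.some_inj] at h1
  rw [ZMod.intCast_eq_intCast_iff'] at h1
  push_cast at h1
  rw [Int.emod_eq_of_lt hi hik, Int.emod_eq_of_lt hi' hik'] at h1
  subst h1
  rw [mul_assoc, mul_assoc, mul_right_inj] at h
  obtain rfl := a_exponent_unique hk h
  exact ⟨rfl, rfl, b_zpow_injective (mul_left_cancel h)⟩

/-! ### The set T in normal-form parameters -/

/-- The parameters `(i, e, j)` of the words `b ^ i * a ^ e * b ^ j` in `T(p, q)` with `e ≠ 0`. -/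
def IsIndex (k : ℕ) (p q i e j : ℤ) : Prop :=
  (0 ≤ i ∧ i < 2 ^ k) ∧
    (e = -p ∧ -q + 1 ≤ j ∧ j ≤ (2 ^ k + 1) * q ∧ (i = 0 → j ≤ (2 ^ k + 1) * q - 2 ^ k) ∨
      e = p ∧ -q + 2 ≤ j ∧ j ≤ (2 ^ k + 1) * q)

/-- The greatest exponent of `b` in `Z_0(p, q)`. -/
def zMax (k : ℕ) (q : ℤ) : ℤ := 2 ^ k * ((q + 1) / 2) + (q - 1)

theorem mem_T_iff {p q : ℤ} (x : GroupP k) :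
    x ∈ T k p q ↔ (∃ i e j, IsIndex k p q i e j ∧ b k ^ i * a k ^ e * b k ^ j = x) ∨
      ∃ z, -zMax k q ≤ z ∧ z ≤ zMax k q ∧ b k ^ z = x := by
  have hZ : -(2 ^ k * ((q + 1) / 2)) - (q - 1) = -zMax k q := by rw [zMax]; ring
  have hpos : (0 : ℤ) < 2 ^ k := by positivity
  have hM : (2 ^ k + 1) * q - 2 ^ k ≤ (2 ^ k + 1) * q := by linarith
  constructor
  · rintro (((⟨j, ⟨h1, h2⟩, rfl⟩ | h) | h) | ⟨j, ⟨h1, h2⟩, rfl⟩)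
    · exact Or.inl ⟨0, -p, j, ⟨⟨le_rfl, hpos⟩, Or.inl ⟨rfl, h1, h2.trans hM, fun _ => h2⟩⟩, by simp⟩
    · simp only [Set.mem_iUnion] at h
      obtain ⟨i, ⟨hi1, hi2⟩, j, ⟨h1, h2⟩, rfl⟩ := h
      exact Or.inl ⟨i, -p, j, ⟨⟨by omega, by omega⟩, Or.inl ⟨rfl, h1, h2, by omega⟩⟩, rfl⟩
    · simp only [Set.mem_iUnion] at h
      obtain ⟨i, ⟨hi1, hi2⟩, j, ⟨h1, h2⟩, rfl⟩ := h
      exact Or.inl ⟨i, p, j, ⟨⟨by omega, by omega⟩, Or.inr ⟨rfl, h1, h2⟩⟩, rfl⟩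
    · exact Or.inr ⟨j, hZ ▸ h1, h2, rfl⟩
  · rintro (⟨i, e, j, ⟨⟨hi1, hi2⟩, ⟨rfl, h1, h2, h3⟩ | ⟨rfl, h1, h2⟩⟩, rfl⟩ | ⟨z, h1, h2, rfl⟩)
    · rcases hi1.eq_or_lt with rfl | hi
      · exact Or.inl (Or.inl (Or.inl ⟨j, ⟨h1, h3 rfl⟩, by simp⟩))
      · refine Or.inl (Or.inl (Or.inr ?_))
        simp only [Set.mem_iUnion]
        exact ⟨i, ⟨by omega, by omega⟩, j, ⟨h1, h2⟩, rfl⟩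
    · refine Or.inl (Or.inr ?_)
      simp only [Set.mem_iUnion]
      exact ⟨i, ⟨by omega, by omega⟩, j, ⟨h1, h2⟩, rfl⟩
    · exact Or.inr ⟨z, ⟨by rw [hZ]; exact h1, h2⟩, rfl⟩

theorem IsIndex.odd {p q i e j : ℤ} (h : IsIndex k p q i e j) (hp : Odd p) : Odd e := by
  obtain ⟨-, ⟨rfl, -⟩ | ⟨rfl, -⟩⟩ := h
  exacts [hp.neg, hp]

theorem word_mem_T {p q i e j : ℤ} (h : IsIndex k p q i e j) :
    b k ^ i * a k ^ e * b k ^ j ∈ T k p q :=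
  (mem_T_iff _).2 (Or.inl ⟨i, e, j, h, rfl⟩)

theorem b_zpow_mem_T {p q z : ℤ} (h₁ : -zMax k q ≤ z) (h₂ : z ≤ zMax k q) : b k ^ z ∈ T k p q :=
  (mem_T_iff _).2 (Or.inr ⟨z, h₁, h₂, rfl⟩)

/-! ### Rewriting products of normal forms -/

section Identities

variable {e f : ℤ}

theorem word_eq_word_add (he : Odd e) (t : ℤ) {i j i' j' : ℤ} (hi : i' = i + 2 ^ k * t)
    (hj : j' = j + 2 ^ k * t) :
    b k ^ i * a k ^ e * b k ^ j = b k ^ i' * a k ^ e * b k ^ j' := by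
  have h := zpow_odd_mul_zpow_of_relator (relator_ab k) he t
  push_cast at h
  rw [hi, hj, add_comm j, zpow_add, zpow_add (b k) _ j]
  simp only [mul_assoc]
  rw [← mul_assoc (a k ^ e) (b k ^ (2 ^ k * t)), h]
  group

theorem word_mul_word_eq_of_add (hf : Odd f) (t : ℤ) (i : ℤ) {j l m j' l' m' : ℤ}
    (h : j' + l' = j + l + 2 ^ k * t) (hm : m' = m + 2 ^ k * t) :
    b k ^ i * a k ^ e * b k ^ j * (b k ^ l * a k ^ f * b k ^ m) =
      b k ^ i * a k ^ e * b k ^ j' * (b k ^ l' * a k ^ f * b k ^ m') := by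
  have h1 := word_eq_word_add (k := k) hf t (i := j + l) (j := m) rfl rfl
  rw [← h, ← hm, zpow_add, zpow_add] at h1
  simp only [mul_assoc] at h1 ⊢
  rw [h1]

theorem word_mul_word_flip (i m : ℤ) {j l j' l' e' f' : ℤ} (h : j + l = j' + l')
    (he : e' = -e) (hf : f' = -f) (ho : Odd (j + l) ∧ f = e ∨ Even (j + l) ∧ f = -e) :
    b k ^ i * a k ^ e * b k ^ j * (b k ^ l * a k ^ f * b k ^ m) =
      b k ^ i * a k ^ e' * b k ^ j' * (b k ^ l' * a k ^ f' * b k ^ m) := by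
  have h1 : a k ^ e * b k ^ (j + l) * a k ^ f = a k ^ e' * b k ^ (j' + l') * a k ^ f' := by
    rw [← h, he, hf]
    obtain ⟨ho, rfl⟩ | ⟨ho, rfl⟩ := ho
    · exact zpow_mul_zpow_mul_zpow_of_odd (relator_ba k) ho f
    · rw [neg_neg]
      exact zpow_mul_zpow_mul_zpow_of_even (relator_ba k) ho e
  rw [zpow_add, zpow_add] at h1
  simp only [← mul_assoc] at h1 ⊢
  simp only [mul_assoc (b k ^ i)]
  rw [h1]

/-- The integer c serves to bring i + 1 back into [0, 2^k): the block b^(2^k c) on the left is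
compensated in the middle exponent. -/
theorem word_mul_word_shift {p : ℤ} (hp : Odd p) (t c : ℤ) {i j l m i' j' l' m' : ℤ}
    (hi : i' = i + 1 + 2 ^ k * c) (h : j + l = 2 ^ k * t) (h' : j' + l' = 2 ^ k * (t + c))
    (hm : m' = m - 1) :
    b k ^ i * a k ^ p * b k ^ j * (b k ^ l * a k ^ p * b k ^ m) =
      b k ^ i' * a k ^ (-p) * b k ^ j' * (b k ^ l' * a k ^ (-p) * b k ^ m') := by
  have h1 := zpow_mul_sq_shift (relator_ab k) (relator_ba k) hp i t m
  push_cast at h1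
  rw [word_eq_word_add hp.neg c (i := i + 1) (j := 2 ^ k * t) hi (j' := j' + l')
    (by rw [h']; ring), ← h, zpow_add, zpow_add, ← hm] at h1
  simpa only [mul_assoc] using h1

theorem word_mul_word_cancel (he : Odd e) (i m : ℤ) {j l t s : ℤ} (h : j + l = 2 ^ k * t)
    (hs : s = i - 2 ^ k * t + m) :
    b k ^ i * a k ^ e * b k ^ j * (b k ^ l * a k ^ (-e) * b k ^ m) = b k ^ s := by
  have h1 := zpow_odd_mul_zpow_of_relator (relator_ab k) he t
  push_cast at h1
  rw [← h, zpow_add, ← mul_assoc] at h1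
  simp only [← mul_assoc]
  simp only [mul_assoc (b k ^ i)]
  rw [h1, h, hs]
  group

end Identities

/-! ### A second factorization of every product -/

section Factorizations

variable {p q : ℤ}

theorem zMax_facts (hk : 0 < k) (hq : 0 < q) (hqo : Odd q) (hd : (2 ^ k : ℤ) ∣ q - 1) :
    2 ≤ (2 ^ k : ℤ) ∧ 2 ^ k + q ≤ (2 ^ k + 1) * q ∧
      2 * zMax k q = (2 ^ k + 1) * q + q + 2 ^ k - 2 ∧ (2 ^ k : ℤ) ∣ zMax k q := by
  have h2 : 2 ≤ (2 ^ k : ℤ) := by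
    obtain ⟨n, rfl⟩ := Nat.exists_eq_succ_of_ne_zero hk.ne'
    have : (0 : ℤ) < 2 ^ n := by positivity
    rw [Nat.succ_eq_add_one, pow_succ]
    omega
  refine ⟨h2, by nlinarith, ?_, (dvd_mul_right _ _).add hd⟩
  obtain ⟨n, rfl⟩ := hqo
  have : (2 * n + 1 + 1) / 2 = n + 1 := by omega
  rw [zMax, this]
  ring

theorem exists_b_zpow_mul_b_zpow (s : ℤ) (h₁ : -(2 * zMax k q) ≤ s) (h₂ : s ≤ 2 * zMax k q) :
    ∃ z z' : ℤ, b k ^ z ∈ T k p q ∧ b k ^ z' ∈ T k p q ∧ b k ^ z * b k ^ z' = b k ^ s :=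
  ⟨s / 2, s - s / 2, b_zpow_mem_T (by omega) (by omega), b_zpow_mem_T (by omega) (by omega), by
    rw [← zpow_add, add_sub_cancel]⟩

theorem b_zpow_mul_b_zpow_other (hk : 0 < k) (hp : Odd p) (hq : 0 < q) (hqo : Odd q)
    (hd : (2 ^ k : ℤ) ∣ q - 1) {z z' : ℤ} (hz₁ : -zMax k q ≤ z) (hz₂ : z ≤ zMax k q)
    (hz₁' : -zMax k q ≤ z') (hz₂' : z' ≤ zMax k q) :
    ∃ u ∈ T k p q, ∃ v ∈ T k p q, u * v = b k ^ z * b k ^ z' ∧ u ≠ b k ^ z := by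
  obtain ⟨h2, hM, hZ, -⟩ := zMax_facts hk hq hqo hd
  obtain ⟨c, hc⟩ := hd
  have slide : ∀ d : ℤ, d ≠ 0 → -zMax k q ≤ z + d → z + d ≤ zMax k q → -zMax k q ≤ z' - d →
      z' - d ≤ zMax k q →
      ∃ u ∈ T k p q, ∃ v ∈ T k p q, u * v = b k ^ z * b k ^ z' ∧ u ≠ b k ^ z := by
    intro d hd0 h1 h2 h3 h4
    refine ⟨_, b_zpow_mem_T h1 h2, _, b_zpow_mem_T h3 h4, ?_, fun h => hd0 ?_⟩
    · rw [← zpow_add, ← zpow_add]; congr 1; ring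
    · simpa using b_zpow_injective h
  by_cases h1 : z < zMax k q ∧ -zMax k q < z'
  · exact slide 1 one_ne_zero (by omega) (by omega) (by omega) (by omega)
  by_cases h2 : -zMax k q < z ∧ z' < zMax k q
  · exact slide (-1) (by simp) (by omega) (by omega) (by omega) (by omega)
  -- Only the two extreme powers b^(±2 zMax) are left; they are products of extreme words from
  -- X_(2^k-1) and Y_0, in the two orders.
  obtain ⟨rfl, rfl⟩ | ⟨rfl, rfl⟩ :
      z = zMax k q ∧ z' = zMax k q ∨ z = -zMax k q ∧ z' = -zMax k q := by omega
  · refine ⟨_, word_mem_T (i := 2 ^ k - 1) (e := -p) (j := -q + 1) ?_, _,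
      word_mem_T (i := 0) (e := p) (j := (2 ^ k + 1) * q) ?_, ?_, word_ne_b_zpow hp.neg _ _ _⟩
    · exact ⟨⟨by omega, by omega⟩, Or.inl ⟨rfl, by omega, by omega, by omega⟩⟩
    · exact ⟨⟨by omega, by omega⟩, Or.inr ⟨rfl, by omega, by omega⟩⟩
    · rw [← zpow_add]
      nth_rw 2 [← neg_neg p]
      exact word_mul_word_cancel hp.neg _ _ (t := -c) (by linarith) (by linarith)
  · refine ⟨_, word_mem_T (i := 0) (e := p) (j := (2 ^ k + 1) * q) ?_, _,
      word_mem_T (i := 2 ^ k - 1) (e := -p) (j := -q + 1) ?_, ?_, word_ne_b_zpow hp _ _ _⟩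
    · exact ⟨⟨by omega, by omega⟩, Or.inr ⟨rfl, by omega, by omega⟩⟩
    · exact ⟨⟨by omega, by omega⟩, Or.inl ⟨rfl, by omega, by omega, by omega⟩⟩
    · rw [← zpow_add]
      exact word_mul_word_cancel hp _ _ (t := c + q + 1) (by linarith) (by linarith)

theorem b_zpow_mul_word_other (hk : 0 < k) (hp : Odd p) (hq : 0 < q) (hqo : Odd q)
    (hd : (2 ^ k : ℤ) ∣ q - 1) {z l e j : ℤ} (hz₁ : -zMax k q ≤ z) (hz₂ : z ≤ zMax k q)
    (h : IsIndex k p q l e j) :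
    ∃ u ∈ T k p q, ∃ v ∈ T k p q,
      u * v = b k ^ z * (b k ^ l * a k ^ e * b k ^ j) ∧ u ≠ b k ^ z := by
  obtain ⟨h2, hM, hZ, ζ, hζ⟩ := zMax_facts hk hq hqo hd
  have he := h.odd hp
  have hpos : (0 : ℤ) < 2 ^ k := by positivity
  set t := (z + l) / 2 ^ k with ht
  set r := (z + l) % 2 ^ k with hr
  have hr0 : 0 ≤ r := Int.emod_nonneg _ hpos.ne'
  have hrN : r < 2 ^ k := Int.emod_lt_of_pos _ hpos
  have hrt : 2 ^ k * t + r = z + l := Int.mul_ediv_add_emod _ _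
  -- After reducing z + l modulo 2^k, the product is b^r a^e b^(j - 2^k t). Its right exponent is
  -- split so that the power of b becomes the second factor.
  have key : ∃ w y : ℤ, IsIndex k p q r e w ∧ -zMax k q ≤ y ∧ y ≤ zMax k q ∧
      w + y = j - 2 ^ k * t := by
    obtain ⟨⟨hl0, hlN⟩, hj⟩ := h
    have ht1 : 2 ^ k * t ≤ zMax k q := by
      have : t < ζ + 1 := by
        refine lt_of_mul_lt_mul_left (a := (2 ^ k : ℤ)) ?_ hpos.le
        linarith
      have : 2 ^ k * t ≤ 2 ^ k * ζ := by gcongr; omega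
      linarith
    have ht2 : -zMax k q ≤ 2 ^ k * t := by
      have : -ζ < t + 1 := by
        refine lt_of_mul_lt_mul_left (a := (2 ^ k : ℤ)) ?_ hpos.le
        linarith
      have : 2 ^ k * -ζ ≤ 2 ^ k * t := by gcongr; omega
      linarith
    -- This gain of 2^k offsets the shorter range of X_0 when the reduction turns a nonzero l into r
    -- = 0.
    have ht3 : r = 0 → l ≠ 0 → -zMax k q + 2 ^ k ≤ 2 ^ k * t := by
      intro hr0 hl0
      have : -ζ < t := by
        refine lt_of_mul_lt_mul_left (a := (2 ^ k : ℤ)) ?_ hpos.le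
        rw [mul_neg]
        omega
      have : 2 ^ k * (-ζ + 1) ≤ 2 ^ k * t := by gcongr; omega
      linarith
    generalize 2 ^ k * t = τ at *
    rcases hj with ⟨rfl, h1, h3, h4⟩ | ⟨rfl, h1, h3⟩
    · rcases le_total (j - τ) (-q + 1 + zMax k q) with h5 | h5
      · exact ⟨-q + 1, j - τ - (-q + 1), ⟨⟨hr0, hrN⟩, Or.inl ⟨rfl, by omega, by omega, by omega⟩⟩,
          by omega, by omega, by ring⟩
      · refine ⟨j - τ - zMax k q, zMax k q,
          ⟨⟨hr0, hrN⟩, Or.inl ⟨rfl, by omega, by omega, ?_⟩⟩, by omega, by omega, by ring⟩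
        intro hr
        by_cases hl : l = 0
        · have := h4 hl; omega
        · have := ht3 hr hl; omega
    · rcases le_total (j - τ) (-q + 2 + zMax k q) with h5 | h5
      · exact ⟨-q + 2, j - τ - (-q + 2), ⟨⟨hr0, hrN⟩, Or.inr ⟨rfl, by omega, by omega⟩⟩,
          by omega, by omega, by ring⟩
      · exact ⟨j - τ - zMax k q, zMax k q, ⟨⟨hr0, hrN⟩, Or.inr ⟨rfl, by omega, by omega⟩⟩,
          by omega, by omega, by ring⟩
  obtain ⟨w, y, hw, hy1, hy2, hwy⟩ := key
  refine ⟨_, word_mem_T hw, _, b_zpow_mem_T hy1 hy2, ?_, word_ne_b_zpow he _ _ _⟩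
  have := word_eq_word_add (k := k) he t (i := r) (j := w + y) (i' := z + l) (j' := j)
    (by linarith) (by linarith)
  rw [zpow_add, zpow_add] at this
  simpa only [mul_assoc] using this

theorem word_mul_b_zpow_other (hk : 0 < k) (hp : Odd p) (hq : 0 < q) (hqo : Odd q)
    (hd : (2 ^ k : ℤ) ∣ q - 1) {z i e j : ℤ} (h : IsIndex k p q i e j) (hz₁ : -zMax k q ≤ z)
    (hz₂ : z ≤ zMax k q) :
    ∃ u ∈ T k p q, ∃ v ∈ T k p q, u * v = b k ^ i * a k ^ e * b k ^ j * b k ^ z ∧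
      u ≠ b k ^ i * a k ^ e * b k ^ j := by
  obtain ⟨h2, hM, hZ, ζ, hζ⟩ := zMax_facts hk hq hqo hd
  have he := h.odd hp
  have slide : ∀ d : ℤ, d ≠ 0 → IsIndex k p q i e (j + d) → -zMax k q ≤ z - d →
      z - d ≤ zMax k q →
      ∃ u ∈ T k p q, ∃ v ∈ T k p q, u * v = b k ^ i * a k ^ e * b k ^ j * b k ^ z ∧
        u ≠ b k ^ i * a k ^ e * b k ^ j := by
    intro d hd0 h1 h3 h4
    refine ⟨_, word_mem_T h1, _, b_zpow_mem_T h3 h4, by group, fun h => hd0 ?_⟩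
    simpa using b_zpow_injective (mul_left_cancel h)
  -- At z = ±zMax sliding may be impossible, but 2^k divides zMax, so b^z crosses the whole word and
  -- comes out on the left as b^(-z).
  have swap : ∀ t : ℤ, z = 2 ^ k * t →
      ∃ u ∈ T k p q, ∃ v ∈ T k p q, u * v = b k ^ i * a k ^ e * b k ^ j * b k ^ z ∧
        u ≠ b k ^ i * a k ^ e * b k ^ j := by
    intro t ht
    refine ⟨b k ^ (-z), b_zpow_mem_T (by omega) (by omega), _, word_mem_T h, ?_,
      (word_ne_b_zpow he _ _ _).symm⟩
    have := word_eq_word_add (k := k) he t (i := -z + i) (j := j) (i' := i) (j' := j + z)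
      (by linarith) (by linarith)
    rw [zpow_add, zpow_add] at this
    simpa only [mul_assoc] using this
  by_cases h1 : z = zMax k q
  · exact swap ζ (h1.trans hζ)
  by_cases h3 : z = -zMax k q
  · exact swap (-ζ) (by rw [h3, hζ]; ring)
  by_cases h4 : IsIndex k p q i e (j + 1)
  · exact slide 1 one_ne_zero h4 (by omega) (by omega)
  · refine slide (-1) (by simp) ?_ (by omega) (by omega)
    unfold IsIndex at h h4 ⊢
    omega

theorem isIndex_neg (hp0 : 0 < p) {i j : ℤ} : IsIndex k p q i (-p) j ↔
    (0 ≤ i ∧ i < 2 ^ k) ∧ -q + 1 ≤ j ∧ j ≤ (2 ^ k + 1) * q ∧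
      (i = 0 → j ≤ (2 ^ k + 1) * q - 2 ^ k) := by
  have : -p ≠ p := by omega
  simp only [IsIndex, this, true_and, false_and, or_false]

theorem isIndex_self (hp0 : 0 < p) {i j : ℤ} : IsIndex k p q i p j ↔
    (0 ≤ i ∧ i < 2 ^ k) ∧ -q + 2 ≤ j ∧ j ≤ (2 ^ k + 1) * q := by
  have : p ≠ -p := by omega
  simp only [IsIndex, this, true_and, false_and, false_or]

/-- The pairs of words in `T(p, q)` whose product does not arise from another pair by moving a
power of `b` between the factors. -/
theorem extremal_cases (hp0 : 0 < p) (hq : 0 < q) (h2 : 2 ≤ (2 ^ k : ℤ))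
    (hM : 2 ^ k + q ≤ (2 ^ k + 1) * q) {i e j l f m : ℤ} (h : IsIndex k p q i e j)
    (h' : IsIndex k p q l f m)
    (h1 : ¬(IsIndex k p q i e (j + 1) ∧ IsIndex k p q (l - 1) f m))
    (h3 : ¬(IsIndex k p q i e (j - 1) ∧ IsIndex k p q (l + 1) f m))
    (h4 : ¬(IsIndex k p q i e (j + 1) ∧ IsIndex k p q (2 ^ k - 1) f (m + 2 ^ k) ∧ l = 0))
    (h5 : ¬(IsIndex k p q i e (j - 1) ∧ IsIndex k p q 0 f (m - 2 ^ k) ∧ l = 2 ^ k - 1)) :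
    (2 ^ k + 1) * q - 2 ^ k < m ∧ (l = 0 ∧ p = f ∨ l = 1 ∧ -p = f) ∧
        (-p = e ∧ j = -q + 1 ∨ p = e ∧ j = -q + 2) ∨
      l = 2 ^ k - 1 ∧ m < -q + 2 + 2 ^ k ∧ (-p = f ∨ p = f) ∧
        (-p = e ∧ i = 0 ∧ j = (2 ^ k + 1) * q - 2 ^ k ∨
          -p = e ∧ 0 < i ∧ j = (2 ^ k + 1) * q ∨ p = e ∧ j = (2 ^ k + 1) * q) := by
  have hne : p ≠ -p := by omega
  have he : e = -p ∨ e = p := h.2.imp And.left And.left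
  have hf : f = -p ∨ f = p := h'.2.imp And.left And.left
  have hup : ¬IsIndex k p q i e (j + 1) → -p = e ∧ i = 0 ∧ j = (2 ^ k + 1) * q - 2 ^ k ∨
      -p = e ∧ 0 < i ∧ j = (2 ^ k + 1) * q ∨ p = e ∧ j = (2 ^ k + 1) * q := by
    intro hn
    rcases he with rfl | rfl
    · rw [isIndex_neg hp0] at h hn; omega
    · rw [isIndex_self hp0] at h hn; omega
  have hdown : ¬IsIndex k p q i e (j - 1) → -p = e ∧ j = -q + 1 ∨ p = e ∧ j = -q + 2 := by
    intro hn
    rcases he with rfl | rfl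
    · rw [isIndex_neg hp0] at h hn; omega
    · rw [isIndex_self hp0] at h hn; omega
  have hupdown : IsIndex k p q i e (j + 1) ∨ IsIndex k p q i e (j - 1) := by
    rcases he with rfl | rfl
    · rw [isIndex_neg hp0] at h ⊢; rw [isIndex_neg hp0]; omega
    · rw [isIndex_self hp0] at h ⊢; rw [isIndex_self hp0]; omega
  by_cases hu : IsIndex k p q i e (j + 1)
  · have h1' := not_and.mp h1 hu
    have h4' := not_and.mp h4 hu
    by_cases hv : IsIndex k p q i e (j - 1)
    · have h3' := not_and.mp h3 hv
      have h5' := not_and.mp h5 hv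
      exfalso
      rcases hf with rfl | rfl
      · rw [isIndex_neg hp0] at h' h1' h3' h5'; omega
      · rw [isIndex_self hp0] at h' h1' h3' h4'; omega
    · refine Or.inl ⟨?_, ?_, hdown hv⟩ <;> rcases hf with rfl | rfl
      · rw [isIndex_neg hp0] at h' h1' h4'; omega
      · rw [isIndex_self hp0] at h' h1' h4'; omega
      · rw [isIndex_neg hp0] at h' h1' h4'; omega
      · rw [isIndex_self hp0] at h' h1' h4'; omega
  · have hv := hupdown.resolve_left hu
    have h3' := not_and.mp h3 hv
    have h5' := not_and.mp h5 hv
    refine Or.inr ⟨?_, ?_, hf.imp Eq.symm Eq.symm, hup hu⟩ <;> rcases hf with rfl | rfl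
    · rw [isIndex_neg hp0] at h' h3'; omega
    · rw [isIndex_self hp0] at h' h3'; omega
    · rw [isIndex_neg hp0] at h' h3' h5'; omega
    · rw [isIndex_self hp0] at h' h3' h5'; omega

theorem word_mul_word_other (hk : 0 < k) (hp0 : 0 < p) (hp : Odd p) (hq : 0 < q) (hqo : Odd q)
    (hd : (2 ^ k : ℤ) ∣ q - 1) {i e j l f m : ℤ} (h : IsIndex k p q i e j)
    (h' : IsIndex k p q l f m) :
    ∃ u ∈ T k p q, ∃ v ∈ T k p q,
      u * v = b k ^ i * a k ^ e * b k ^ j * (b k ^ l * a k ^ f * b k ^ m) ∧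
        u ≠ b k ^ i * a k ^ e * b k ^ j := by
  obtain ⟨h2, hM, hZ, -⟩ := zMax_facts hk hq hqo hd
  obtain ⟨c, hc⟩ := hd
  have he := h.odd hp
  have hf := h'.odd hp
  have other : ∀ {i' e' j' l' f' m' : ℤ}, IsIndex k p q i' e' j' → IsIndex k p q l' f' m' →
      ¬(i' = i ∧ e' = e ∧ j' = j) →
      b k ^ i * a k ^ e * b k ^ j * (b k ^ l * a k ^ f * b k ^ m) =
        b k ^ i' * a k ^ e' * b k ^ j' * (b k ^ l' * a k ^ f' * b k ^ m') →
      ∃ u ∈ T k p q, ∃ v ∈ T k p q,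
        u * v = b k ^ i * a k ^ e * b k ^ j * (b k ^ l * a k ^ f * b k ^ m) ∧
          u ≠ b k ^ i * a k ^ e * b k ^ j := by
    intro i' e' j' l' f' m' h1 h3 hne heq
    refine ⟨_, word_mem_T h1, _, word_mem_T h3, heq.symm, fun h4 => hne ?_⟩
    exact word_injective hk (h1.odd hp) he h1.1.1 h.1.1 h1.1.2 h.1.2 h4
  have cancel : ∀ t : ℤ, j + l = 2 ^ k * t → f = -e → -(2 * zMax k q) ≤ i - 2 ^ k * t + m →
      i - 2 ^ k * t + m ≤ 2 * zMax k q →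
      ∃ u ∈ T k p q, ∃ v ∈ T k p q,
        u * v = b k ^ i * a k ^ e * b k ^ j * (b k ^ l * a k ^ f * b k ^ m) ∧
          u ≠ b k ^ i * a k ^ e * b k ^ j := by
    rintro t ht rfl h1 h3
    obtain ⟨z, z', hz, hz', hzz⟩ := exists_b_zpow_mul_b_zpow (p := p) _ h1 h3
    exact ⟨_, hz, _, hz', hzz.trans (word_mul_word_cancel he i m ht rfl).symm,
      (word_ne_b_zpow he _ _ _).symm⟩
  -- Slide a letter `b` from one factor to the other.
  by_cases h1 : IsIndex k p q i e (j + 1) ∧ IsIndex k p q (l - 1) f m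
  · exact other h1.1 h1.2 (by omega) (word_mul_word_eq_of_add hf 0 i (by ring) (by ring))
  by_cases h3 : IsIndex k p q i e (j - 1) ∧ IsIndex k p q (l + 1) f m
  · exact other h3.1 h3.2 (by omega) (word_mul_word_eq_of_add hf 0 i (by ring) (by ring))
  -- Slide a power `b ^ (2 ^ k)`.
  by_cases h4 : IsIndex k p q i e (j + 1) ∧ IsIndex k p q (2 ^ k - 1) f (m + 2 ^ k) ∧ l = 0
  · exact other h4.1 h4.2.1 (by omega)
      (word_mul_word_eq_of_add hf 1 i (by rw [h4.2.2]; ring) (by ring))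
  by_cases h5 : IsIndex k p q i e (j - 1) ∧ IsIndex k p q 0 f (m - 2 ^ k) ∧ l = 2 ^ k - 1
  · exact other h5.1 h5.2.1 (by omega)
      (word_mul_word_eq_of_add hf (-1) i (by rw [h5.2.2]; ring) (by ring))
  obtain ⟨⟨hi0, hiN⟩, hj⟩ := h
  obtain ⟨⟨hl0, hlN⟩, hm⟩ := h'
  -- The remaining extremal pairs.
  have hcase := extremal_cases hp0 hq h2 hM ⟨⟨hi0, hiN⟩, hj⟩ ⟨⟨hl0, hlN⟩, hm⟩ h1 h3 h4 h5
  clear h1 h3 h4 h5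
  -- With q - 1 = 2^k c, the middle exponent at the top end of an interval with l = 2^k - 1 is a
  -- multiple of 2^k, as cancelling and shifting require.
  have ht : (2 ^ k + 1) * q + (2 ^ k - 1) = 2 ^ k * (c + q + 1) := by linarith
  have ht' : (2 ^ k + 1) * q - 2 ^ k + (2 ^ k - 1) = 2 ^ k * (c + q) := by linarith
  rcases hcase with ⟨hm', ⟨rfl, rfl⟩ | ⟨rfl, rfl⟩, ⟨rfl, rfl⟩ | ⟨rfl, rfl⟩⟩ |
    ⟨rfl, hm', rfl | rfl, ⟨rfl, rfl, rfl⟩ | ⟨rfl, hi, rfl⟩ | ⟨rfl, rfl⟩⟩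
  -- In the four cases with j at the bottom, the middle exponent is 1 - q, a multiple of 2^k, or 2 -
  -- q (odd, twice), or 3 - q (even): cancel once, then flip.
  · exact cancel (-c) (by linarith) (by simp) (by rw [mul_neg, ← hc]; omega)
      (by rw [mul_neg, ← hc]; omega)
  · refine other (i' := i) (e' := -p) (j' := -q + 1) (l' := 1) (f' := -p) (m' := m)
      ⟨⟨by omega, by omega⟩, Or.inl ⟨rfl, by omega, by omega, by omega⟩⟩
      ⟨⟨by omega, by omega⟩, Or.inl ⟨rfl, by omega, by omega, by omega⟩⟩ (by omega)
      (word_mul_word_flip i m (by ring) rfl rfl (Or.inl ⟨?_, rfl⟩))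
    rw [add_zero]
    exact hqo.neg.add_even even_two
  · refine other (i' := i) (e' := p) (j' := -q + 2) (l' := 0) (f' := p) (m' := m)
      ⟨⟨by omega, by omega⟩, Or.inr ⟨rfl, by omega, by omega⟩⟩
      ⟨⟨by omega, by omega⟩, Or.inr ⟨rfl, by omega, by omega⟩⟩ (by omega)
      (word_mul_word_flip i m (by ring) (by simp) (by simp) (Or.inl ⟨?_, rfl⟩))
    rw [add_assoc]
    exact hqo.neg.add_even even_two
  · refine other (i' := i) (e' := -p) (j' := -q + 2) (l' := 1) (f' := p) (m' := m)
      ⟨⟨by omega, by omega⟩, Or.inl ⟨rfl, by omega, by omega, by omega⟩⟩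
      ⟨⟨by omega, by omega⟩, Or.inr ⟨rfl, by omega, by omega⟩⟩ (by omega)
      (word_mul_word_flip i m (by ring) rfl (by simp) (Or.inr ⟨?_, rfl⟩))
    exact (hqo.neg.add_even even_two).add_odd odd_one
  -- In the six cases with j at the top, opposite signs cancel and equal signs shift. The shift
  -- changes m by 1, matching the lower ends 1 - q of X_i and 2 - q of Y_l.
  · exact other (i' := 2 ^ k - 1) (e' := p) (j' := (2 ^ k + 1) * q) (l' := 2 ^ k - 1) (f' := p)
      (m' := m + 1) ⟨⟨by omega, by omega⟩, Or.inr ⟨rfl, by omega, by omega⟩⟩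
      ⟨⟨by omega, by omega⟩, Or.inr ⟨rfl, by omega, by omega⟩⟩ (by omega)
      (word_mul_word_shift hp (c + q + 1) (-1) (by ring) ht (ht'.trans (by ring)) (by ring)).symm
  · exact other (i' := i - 1) (e' := p) (j' := (2 ^ k + 1) * q) (l' := 2 ^ k - 1) (f' := p)
      (m' := m + 1) ⟨⟨by omega, by omega⟩, Or.inr ⟨rfl, by omega, by omega⟩⟩
      ⟨⟨by omega, by omega⟩, Or.inr ⟨rfl, by omega, by omega⟩⟩ (by omega)
      (word_mul_word_shift hp (c + q + 1) 0 (by ring) ht (ht.trans (by ring)) (by ring)).symm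
  · exact cancel _ ht rfl (by omega) (by omega)
  · exact cancel _ ht' (by simp) (by omega) (by omega)
  · exact cancel _ ht (by simp) (by omega) (by omega)
  -- Here i + 1 wraps around to 0 and costs 2^k in the middle exponent; hence the upper end of X_0
  -- is lower by 2^k.
  · by_cases hi : i = 2 ^ k - 1
    · exact other (i' := 0) (e' := -p) (j' := (2 ^ k + 1) * q - 2 ^ k) (l' := 2 ^ k - 1)
        (f' := -p) (m' := m - 1)
        ⟨⟨by omega, by omega⟩, Or.inl ⟨rfl, by omega, by omega, by omega⟩⟩
        ⟨⟨by omega, by omega⟩, Or.inl ⟨rfl, by omega, by omega, by omega⟩⟩ (by omega)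
        (word_mul_word_shift hp (c + q + 1) (-1) (by rw [hi]; ring) ht (ht'.trans (by ring)) rfl)
    · exact other (i' := i + 1) (e' := -p) (j' := (2 ^ k + 1) * q) (l' := 2 ^ k - 1)
        (f' := -p) (m' := m - 1)
        ⟨⟨by omega, by omega⟩, Or.inl ⟨rfl, by omega, by omega, by omega⟩⟩
        ⟨⟨by omega, by omega⟩, Or.inl ⟨rfl, by omega, by omega, by omega⟩⟩ (by omega)
        (word_mul_word_shift hp (c + q + 1) 0 (by ring) ht (ht.trans (by ring)) rfl)

end Factorizations

/-! ### Counting T and distinguishing the sets T(p, q) -/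

/-- The parameters `(i, e, j)` of all elements `b ^ i * a ^ e * b ^ j` of `T(p, q)`. -/
noncomputable def indices (k : ℕ) (p q : ℤ) : Finset (ℤ × ℤ × ℤ) :=
  ((({0} ×ˢ {-p} ×ˢ Finset.Icc (-q + 1) ((2 ^ k + 1) * q - 2 ^ k)) ∪
    (Finset.Icc 1 (2 ^ k - 1) ×ˢ {-p} ×ˢ Finset.Icc (-q + 1) ((2 ^ k + 1) * q))) ∪
    (Finset.Icc 0 (2 ^ k - 1) ×ˢ {p} ×ˢ Finset.Icc (-q + 2) ((2 ^ k + 1) * q))) ∪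
    ({0} ×ˢ {0} ×ˢ Finset.Icc (-zMax k q) (zMax k q))

theorem mem_indices {p q i e j : ℤ} : (i, e, j) ∈ indices k p q ↔
    IsIndex k p q i e j ∨ i = 0 ∧ e = 0 ∧ -zMax k q ≤ j ∧ j ≤ zMax k q := by
  have hpos : (0 : ℤ) < 2 ^ k := by positivity
  simp only [indices, Finset.mem_union, Finset.mem_product, Finset.mem_singleton, Finset.mem_Icc,
    IsIndex]
  omega

theorem T_eq_image {p q : ℤ} :
    T k p q = (fun w : ℤ × ℤ × ℤ => b k ^ w.1 * a k ^ w.2.1 * b k ^ w.2.2) '' indices k p q := by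
  ext x
  rw [mem_T_iff]
  constructor
  · rintro (⟨i, e, j, h, rfl⟩ | ⟨z, h1, h2, rfl⟩)
    · exact ⟨(i, e, j), mem_indices.2 (Or.inl h), rfl⟩
    · exact ⟨(0, 0, z), mem_indices.2 (Or.inr ⟨rfl, rfl, h1, h2⟩), by simp⟩
  · rintro ⟨⟨i, e, j⟩, h, rfl⟩
    obtain h | ⟨rfl, rfl, h1, h2⟩ := mem_indices.1 h
    · exact Or.inl ⟨i, e, j, h, rfl⟩
    · exact Or.inr ⟨j, h1, h2, by simp⟩

theorem finite_T {p q : ℤ} : (T k p q).Finite := by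
  rw [T_eq_image]
  exact (Finset.finite_toSet _).image _

theorem isNonUniqueProductSet_T (hk : 0 < k) {p q : ℤ} (hp0 : 0 < p) (hp : Odd p) (hq : 0 < q)
    (hqo : Odd q) (hd : (2 ^ k : ℤ) ∣ q - 1) :
    IsNonUniqueProductSet (T k p q) := by
  obtain ⟨h2, hM, hZ, -⟩ := zMax_facts hk hq hqo hd
  refine ⟨finite_T, ⟨_, b_zpow_mem_T (z := 0) (by omega) (by omega)⟩, ?_⟩
  rintro g - ⟨⟨x, y⟩, ⟨hx, hy, hxy⟩, huniq⟩
  dsimp only at hx hy hxy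
  obtain ⟨u, hu, v, hv, huv, hne⟩ :
      ∃ u ∈ T k p q, ∃ v ∈ T k p q, u * v = x * y ∧ u ≠ x := by
    obtain ⟨i, e, j, hi, rfl⟩ | ⟨z, hz1, hz2, rfl⟩ := (mem_T_iff x).1 hx <;>
      obtain ⟨l, f, m, hl, rfl⟩ | ⟨z', hz1', hz2', rfl⟩ := (mem_T_iff y).1 hy
    · exact word_mul_word_other hk hp0 hp hq hqo hd hi hl
    · exact word_mul_b_zpow_other hk hp hq hqo hd hi hz1' hz2'
    · exact b_zpow_mul_word_other hk hp hq hqo hd hz1 hz2 hl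
    · exact b_zpow_mul_b_zpow_other hk hp hq hqo hd hz1 hz2 hz1' hz2'
  exact hne (congrArg Prod.fst (huniq (u, v) ⟨hu, hv, huv.trans hxy⟩))

theorem injOn_indices (hk : 0 < k) {p q : ℤ} (hp : Odd p) :
    Set.InjOn (fun w : ℤ × ℤ × ℤ => b k ^ w.1 * a k ^ w.2.1 * b k ^ w.2.2) (indices k p q) := by
  rintro ⟨i, e, j⟩ h ⟨i', e', j'⟩ h' heq
  dsimp only at heq
  obtain h | ⟨rfl, rfl, -⟩ := mem_indices.1 h <;>
    obtain h' | ⟨rfl, rfl, -⟩ := mem_indices.1 h'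
  · obtain ⟨rfl, rfl, rfl⟩ := word_injective hk (h.odd hp) (h'.odd hp) h.1.1 h'.1.1 h.1.2 h'.1.2 heq
    rfl
  · exact absurd (by simpa using heq) (word_ne_b_zpow (h.odd hp) i j j')
  · exact absurd (by simpa using heq.symm) (word_ne_b_zpow (h'.odd hp) i' j' j)
  · obtain rfl : j = j' := b_zpow_injective (by simpa using heq)
    rfl

theorem card_indices (hk : 0 < k) {p q : ℤ} (hp0 : 0 < p) (hq : 0 < q) (hqo : Odd q)
    (hd : (2 ^ k : ℤ) ∣ q - 1) :
    ((indices k p q).card : ℤ) = (2 ^ (2 * k + 1) + 5 * 2 ^ k + 2) * q - (2 ^ k + 1) := by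
  obtain ⟨h2, hM, hZ, -⟩ := zMax_facts hk hq hqo hd
  rw [indices, Finset.card_union_of_disjoint, Finset.card_union_of_disjoint,
    Finset.card_union_of_disjoint]
  · simp only [Finset.card_product, Finset.card_singleton, Int.card_Icc, one_mul, Nat.cast_add,
      Nat.cast_mul]
    rw [Int.toNat_of_nonneg (by omega), Int.toNat_of_nonneg (by omega),
      Int.toNat_of_nonneg (by omega), Int.toNat_of_nonneg (by omega),
      Int.toNat_of_nonneg (by omega), Int.toNat_of_nonneg (by omega)]
    rw [pow_succ, pow_mul']
    linear_combination hZ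
  all_goals
    rw [Finset.disjoint_left]
    rintro ⟨i, e, j⟩
    simp only [Finset.mem_union, Finset.mem_product, Finset.mem_singleton, Finset.mem_Icc]
    omega

theorem ncard_T (hk : 0 < k) {p q : ℤ} (hp0 : 0 < p) (hp : Odd p) (hq : 0 < q) (hqo : Odd q)
    (hd : (2 ^ k : ℤ) ∣ q - 1) :
    ((T k p q).ncard : ℤ) = (2 ^ (2 * k + 1) + 5 * 2 ^ k + 2) * q - (2 ^ k + 1) := by
  rw [T_eq_image, (injOn_indices hk hp).ncard_image, Set.ncard_coe_finset,
    card_indices hk hp0 hq hqo hd]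

theorem exists_le_ncard_T (hk : 0 < k) {p : ℤ} (hp0 : 0 < p) (hp : Odd p) (n : ℕ) :
    ∃ q : ℤ, 0 < q ∧ Odd q ∧ (2 ^ k : ℤ) ∣ q - 1 ∧ n ≤ (T k p q).ncard := by
  have hqo : Odd (2 ^ k * (n : ℤ) + 1) :=
    ((even_two.pow_of_ne_zero hk.ne').mul_right _).add_one
  have hd : (2 ^ k : ℤ) ∣ 2 ^ k * (n : ℤ) + 1 - 1 := by simp
  have hpos : (0 : ℤ) < 2 ^ k := by positivity
  have hq : 0 < 2 ^ k * (n : ℤ) + 1 := by positivity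
  refine ⟨2 ^ k * (n : ℤ) + 1, hq, hqo, hd, ?_⟩
  have h := ncard_T hk hp0 hp hq hqo hd
  have h1 : (0 : ℤ) < 2 ^ (2 * k + 1) := by positivity
  zify
  rw [h]
  generalize (2 : ℤ) ^ (2 * k + 1) = A at *
  generalize (2 : ℤ) ^ k = N at *
  have h2 : (n : ℤ) ≤ N * n := le_mul_of_one_le_left (by positivity) hpos
  nlinarith [mul_pos h1 hq, mul_pos hpos hq]

/-- By uniqueness of normal forms, p is the only positive a-exponent occurring in T(p, q). -/
theorem eq_of_T_eq (hk : 0 < k) {p p' q : ℤ} (hp0 : 0 < p) (hp0' : 0 < p') (hp : Odd p)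
    (hp' : Odd p') (hq : 0 < q) (h : T k p q = T k p' q) : p = p' := by
  have hpos : (0 : ℤ) < 2 ^ k := by positivity
  have hM : q < (2 ^ k + 1) * q := by nlinarith
  have hmem : b k ^ (0 : ℤ) * a k ^ p * b k ^ ((2 ^ k + 1) * q) ∈ T k p q :=
    word_mem_T ⟨⟨le_rfl, hpos⟩, Or.inr ⟨rfl, by omega, le_rfl⟩⟩
  rw [h] at hmem
  obtain ⟨i, e, j, hi, heq⟩ | ⟨z, -, -, heq⟩ := (mem_T_iff _).1 hmem
  · obtain ⟨-, rfl, -⟩ := word_injective hk (hi.odd hp') hp hi.1.1 le_rfl hi.1.2 hpos heq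
    obtain ⟨-, ⟨h1, -⟩ | ⟨h1, -⟩⟩ := hi <;> omega
  · exact absurd heq.symm (word_ne_b_zpow hp _ _ _)

end GroupP

theorem theorem1p5 (k : ℕ) (hk : 0 < k) :
    (∀ n : ℕ, ∃ S : Set (GroupP k), IsNonUniqueProductSet S ∧ n ≤ S.ncard) ∧
    (∀ p q : ℤ, 0 < p → Odd p → 0 < q → Odd q → (2 ^ k : ℤ) ∣ q - 1 →
      IsNonUniqueProductSet (GroupP.T k p q) ∧
      ((GroupP.T k p q).ncard : ℤ) = (2 ^ (2 * k + 1) + 5 * 2 ^ k + 2) * q - (2 ^ k + 1)) ∧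
    (∀ p : ℤ, 0 < p → Odd p → ∀ n : ℕ, ∃ q : ℤ, 0 < q ∧ Odd q ∧ (2 ^ k : ℤ) ∣ q - 1 ∧
      n ≤ (GroupP.T k p q).ncard) ∧
    (∀ q : ℤ, 0 < q → Odd q → (2 ^ k : ℤ) ∣ q - 1 →
      {S : Set (GroupP k) | ∃ p : ℤ, 0 < p ∧ Odd p ∧ S = GroupP.T k p q}.Infinite) := by
  refine ⟨fun n => ?_, fun p q hp0 hp hq hqo hd => ⟨?_, ?_⟩, fun p hp0 hp n => ?_,
    fun q hq _ _ => ?_⟩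
  · obtain ⟨q, hq, hqo, hd, hn⟩ := GroupP.exists_le_ncard_T hk one_pos odd_one n
    exact ⟨_, GroupP.isNonUniqueProductSet_T hk one_pos odd_one hq hqo hd, hn⟩
  · exact GroupP.isNonUniqueProductSet_T hk hp0 hp hq hqo hd
  · exact GroupP.ncard_T hk hp0 hp hq hqo hd
  · exact GroupP.exists_le_ncard_T hk hp0 hp n
  · refine Set.infinite_of_injective_forall_mem (f := fun n : ℕ => GroupP.T k (2 * n + 1) q) ?_ ?_
    · intro m n h
      have := GroupP.eq_of_T_eq hk (by positivity) (by positivity) (odd_two_mul_add_one _)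
        (odd_two_mul_add_one _) hq h
      omega
    · exact fun n => ⟨2 * n + 1, by positivity, odd_two_mul_add_one _, rfl⟩
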